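/- Let $m$ be a product of distinct odd primes (the empty product $m=1$ is allowed), and let $\varphi$ denote Euler's totient function. Then the set of real numbers $$\{\pi\}\cup\left\{\arccos\frac{1}{\varphi(r)} : r \text{ a positive divisor of } m \text{ with } r>3\right\}$$ is linearly independent over $\mathbb{Q}$. (This is a set: if two divisors $r\neq s$ of $m$ satisfy $\varphi(r)=\varphi(s)$, the common value $\arccos\frac1{\varphi(r)}$ occurs in it only once.) -/

import Mathlib

/-!
For even `n = 2 * m > 2` the number `z = exp (i arccos (1 / n))` satisfies `z + z⁻¹ = 1 / m`, so a
rational linear relation between `π` and such arccosines is a multiplicative relation between such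
numbers `zᵢ` (attached to distinct `mᵢ`). Every automorphism `σ` sends `zᵢ` to `zᵢ` or `zᵢ⁻¹`,
according to its sign on `√(1 - (2 mᵢ)²)`. Combining the conjugates of a relation isolates the
indices sharing one sign character, that is, one square class of `(2 mᵢ)² - 1`.

Within a square class, all `2 mᵢ` are `x`-coordinates of odd powers `ε ^ kᵢ` of the fundamental
solution `ε` of a single Pell equation. If the largest exponent `k` is `1`, there is a single `mᵢ`.
Otherwise some odd prime `p` divides the `x`-coordinate of `ε ^ k` but not those of smaller powers:
the norm of `Φ_{4 * k}(ε)` is odd and above `k ^ 2` in absolute value, and the primes dividing `k`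
contribute at most a divisor of `k ^ 2` to it. So a prime `p` divides exactly one of the `mᵢ`. Since
`mᵢ zᵢ` and `mᵢ zᵢ⁻¹` are algebraic integers with sum `1`, no other factor of the relation can
compensate `p`, and the exponent of that `zᵢ` vanishes.
-/

open Polynomial

section Arithmetic

theorem lt_two_pow_totient_of_odd {k : ℕ} (hk : Odd k) (hk1 : 1 < k) : k < 2 ^ k.totient := by
  have hpos : 0 < k.totient := Nat.totient_pos.2 (by omega)
  have hdvd := (Nat.modEq_iff_dvd' Nat.one_le_two_pow).1
    (Nat.ModEq.pow_totient (Nat.coprime_two_left.2 hk)).symm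
  have := Nat.one_lt_two_pow hpos.ne'
  have := Nat.le_of_dvd (by omega) hdvd
  omega

theorem two_lt_totient_of_odd {r : ℕ} (hr : Odd r) (h3 : 3 < r) : 2 < r.totient := by
  by_contra! hle
  have hlt := lt_two_pow_totient_of_odd hr (by omega)
  have hpow : 2 ^ r.totient ≤ 2 ^ 2 := Nat.pow_le_pow_right two_pos hle
  omega

theorem dvd_sq_of_forall_prime_dvd_not_cube_dvd {k n : ℕ}
    (h : ∀ p, p.Prime → p ∣ n → p ∣ k ∧ ¬ p ^ 3 ∣ n) : n ∣ k ^ 2 := by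
  refine (Nat.dvd_iff_prime_pow_dvd_dvd _ _).2 fun p i hp hpi => ?_
  rcases i.eq_zero_or_pos with rfl | hi
  · exact one_dvd _
  obtain ⟨hpk, hcube⟩ := h p hp ((dvd_pow_self p hi.ne').trans hpi)
  have hi2 : i ≤ 2 := by
    by_contra! hi3
    exact hcube ((pow_dvd_pow p hi3).trans hpi)
  exact (pow_dvd_pow p hi2).trans (pow_dvd_pow_of_dvd hpk 2)

theorem exists_eq_mul_sq_of_isSquare_mul {a u : ℤ} (ha : Squarefree a) (h : IsSquare (u * a)) :
    ∃ v, u = a * v ^ 2 := by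
  obtain ⟨y, hy⟩ := h
  obtain ⟨v, rfl⟩ : a ∣ y := ha.isRadical 2 y ⟨u, by rw [sq, ← hy, mul_comm]⟩
  exact ⟨v, mul_right_cancel₀ ha.ne_zero (by linear_combination hy)⟩

theorem isSquare_of_isSquare_mul_sq {b u : ℤ} (hb : b ≠ 0) (h : IsSquare (u * b ^ 2)) :
    IsSquare u := by
  obtain ⟨y, hy⟩ := h
  obtain ⟨v, rfl⟩ : b ∣ y := (Int.pow_dvd_pow_iff two_ne_zero).1 ⟨u, by rw [sq y, ← hy, mul_comm]⟩
  exact ⟨v, mul_right_cancel₀ (pow_ne_zero 2 hb) (by linear_combination hy)⟩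

end Arithmetic

section PellPowers

variable {d : ℤ}

theorem pell_x_mul_add_x_mul_inv (a b : Pell.Solution₁ d) :
    (a * b).x + (a * b⁻¹).x = 2 * a.x * b.x := by
  simp only [Pell.Solution₁.x_mul, Pell.Solution₁.x_inv, Pell.Solution₁.y_inv]
  ring

theorem pell_x_pow_add_two_mul (a : Pell.Solution₁ d) (k j : ℕ) :
    (a ^ (k + 2 * j)).x = 2 * (a ^ (k + j)).x * (a ^ j).x - (a ^ k).x := by
  rw [← pell_x_mul_add_x_mul_inv, ← pow_add, pow_add a k j, mul_inv_cancel_right, add_assoc,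
    ← two_mul, add_sub_cancel_right]

theorem pell_x_sq (a : Pell.Solution₁ d) : (a ^ 2).x = 2 * a.x ^ 2 - 1 := by
  simpa [sq, mul_assoc] using pell_x_pow_add_two_mul a 0 1

theorem pell_even_x_pow_iff (a : Pell.Solution₁ d) (k : ℕ) :
    Even (a ^ k).x ↔ Odd k ∧ Even a.x := by
  induction k using Nat.twoStepInduction with
  | zero => simp
  | one => simp
  | more k ih _ =>
    rw [pell_x_pow_add_two_mul a k 1, mul_assoc, Int.even_sub, ih]
    simp [Nat.odd_add]

theorem pell_x_pow_odd_modEq (a : Pell.Solution₁ d) (j : ℕ) :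
    (a ^ (2 * j + 1)).x ≡ (-1) ^ j * (2 * j + 1) * a.x [ZMOD a.x ^ 3] := by
  induction j using Nat.twoStepInduction with
  | zero => simp [Int.ModEq.refl]
  | one =>
    refine (Int.modEq_of_dvd ⟨4, ?_⟩).symm
    have h : (a ^ 3).x = 2 * (a ^ 2).x * a.x - a.x := by simpa using pell_x_pow_add_two_mul a 1 1
    rw [pell_x_sq] at h
    push_cast
    linear_combination h
  | more j ih₁ ih₂ =>
    have h : (a ^ (2 * (j + 2) + 1)).x =
        2 * (a ^ (2 * (j + 1) + 1)).x * (2 * a.x ^ 2 - 1) - (a ^ (2 * j + 1)).x := by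
      rw [← pell_x_sq]
      exact pell_x_pow_add_two_mul a (2 * j + 1) 2
    rw [h]
    refine (((ih₂.mul_left 2).mul_right _).sub ih₁).trans
      (Int.modEq_of_dvd ⟨4 * (-1) ^ j * (2 * j + 3), ?_⟩)
    push_cast
    ring

theorem pell_x_dvd_x_pow (a : Pell.Solution₁ d) {q : ℕ} (hq : Odd q) : a.x ∣ (a ^ q).x := by
  obtain ⟨j, rfl⟩ := hq
  have hmod := (pell_x_pow_odd_modEq a j).of_dvd (dvd_pow_self a.x three_ne_zero)
  exact hmod.dvd_iff.2 (dvd_mul_left _ _)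

theorem dvd_of_dvd_pell_cofactor {a : Pell.Solution₁ d} (ha : a.x ≠ 0) {q : ℕ} (hq : Odd q)
    {e h : ℤ} (hh : (a ^ q).x = a.x * h) (hex : e ∣ a.x ^ 2) (heh : e ∣ h) : e ∣ q := by
  obtain ⟨j, rfl⟩ := hq
  -- The cofactor is `±q` modulo `a.x ^ 2`.
  have hdvd : a.x ^ 2 ∣ (-1) ^ j * (2 * j + 1) - h := by
    have := (pell_x_pow_odd_modEq a j).dvd
    rw [hh, mul_comm _ a.x, ← mul_sub, pow_succ' a.x 2] at this
    exact (mul_dvd_mul_iff_left ha).1 this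
  have h := (dvd_sub_left heh).1 (hex.trans hdvd)
  push_cast
  exact (IsUnit.dvd_mul_left (isUnit_one.neg.pow j)).1 h

theorem exists_odd_eq_mul_of_dvd_pell_x_pow {a : Pell.Solution₁ d} {p : ℤ} (hp : ¬ IsUnit p) {g : ℕ}
    (hg : p ∣ (a ^ g).x) (hmin : ∀ j, 0 < j → j < g → ¬ p ∣ (a ^ j).x) (k : ℕ)
    (hk : p ∣ (a ^ k).x) : ∃ q, Odd q ∧ k = g * q := by
  induction k using Nat.strong_induction_on with
  | h k ih =>
  have pos_of_dvd {n : ℕ} (hn : p ∣ (a ^ n).x) : 0 < n := by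
    refine Nat.pos_of_ne_zero fun h0 => hp (isUnit_of_dvd_one ?_)
    rwa [h0, pow_zero, Pell.Solution₁.x_one] at hn
  rcases lt_trichotomy k g with hlt | rfl | hlt
  · exact absurd hk (hmin k (pos_of_dvd hk) hlt)
  · exact ⟨1, odd_one, (mul_one k).symm⟩
  rcases le_total (2 * g) k with hle | hle
  · obtain ⟨l, rfl⟩ := Nat.exists_eq_add_of_le' hle
    rw [pell_x_pow_add_two_mul] at hk
    obtain ⟨q, hq, rfl⟩ := ih l (by have := pos_of_dvd hg; omega)
      ((dvd_sub_right (hg.mul_left _)).1 hk)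
    exact ⟨q + 2, hq.add_even even_two, by ring⟩
  · obtain ⟨i, rfl⟩ := Nat.exists_eq_add_of_lt hlt
    obtain ⟨l, rfl⟩ : ∃ l, g = l + (i + 1) := Nat.exists_eq_add_of_le' (by omega)
    rw [show l + (i + 1) + i + 1 = l + 2 * (i + 1) by ring, pell_x_pow_add_two_mul] at hk
    have hl : p ∣ (a ^ l).x := (dvd_sub_right ((hg.mul_left 2).mul_right _)).1 hk
    exact absurd hl (hmin l (pos_of_dvd hl) (by omega))

end PellPowers

section CyclotomicPolynomials

theorem cyclotomic_dvd_X_pow_sub_one_iff {n : ℕ} (hn : n ≠ 0) (m : ℕ) :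
    cyclotomic n ℤ ∣ X ^ m - 1 ↔ n ∣ m := by
  refine ⟨fun h => ?_, fun ⟨k, hk⟩ => (cyclotomic.dvd_X_pow_sub_one n ℤ).trans ?_⟩
  · have hζ := Complex.isPrimitiveRoot_exp n hn
    have hroot := hζ.isRoot_cyclotomic (Nat.pos_of_ne_zero hn)
    have h := (hroot.dvd (by simpa using map_dvd (mapRingHom (Int.castRingHom ℂ)) h)).eq_zero
    exact hζ.dvd_of_pow_eq_one m (by simpa [sub_eq_zero] using h)
  · rw [hk, pow_mul]
    exact sub_one_dvd_pow_sub_one _ k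

theorem X_pow_add_one_mul_cyclotomic_dvd {n q : ℕ} (hn : n ≠ 0) (hq : Odd q) (hq1 : 1 < q) :
    (X ^ n + 1) * cyclotomic (2 * (n * q)) ℤ ∣ X ^ (n * q) + 1 := by
  set Φ := cyclotomic (2 * (n * q)) ℤ
  have hnq : n * q ≠ 0 := mul_ne_zero hn (by omega)
  have hΦ : Prime Φ := (cyclotomic.irreducible (by omega)).prime
  have hdvd {k : ℕ} : Φ ∣ X ^ k - 1 ↔ 2 * (n * q) ∣ k :=
    cyclotomic_dvd_X_pow_sub_one_iff (by omega) k
  have hfactor (k : ℕ) : (X ^ (2 * k) - 1 : ℤ[X]) = (X ^ k - 1) * (X ^ k + 1) := by ring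
  have hΦdvd : Φ ∣ X ^ (n * q) + 1 := by
    refine (hΦ.dvd_or_dvd (hfactor (n * q) ▸ hdvd.2 dvd_rfl)).resolve_left fun h => ?_
    have := Nat.le_of_dvd (by omega) (hdvd.1 h)
    omega
  have hΦndvd : ¬ Φ ∣ X ^ n + 1 := fun h => by
    have := Nat.le_of_dvd (by omega) (hdvd.1 (hfactor n ▸ h.mul_left _))
    have := lt_mul_of_one_lt_right (Nat.pos_of_ne_zero hn) hq1
    omega
  obtain ⟨H, hH⟩ : (X ^ n + 1 : ℤ[X]) ∣ X ^ (n * q) + 1 := by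
    simpa only [pow_mul, one_pow] using hq.add_dvd_pow_add_pow (X ^ n : ℤ[X]) 1
  rw [hH] at hΦdvd ⊢
  exact mul_dvd_mul_left _ ((hΦ.dvd_or_dvd hΦdvd).resolve_left hΦndvd)

theorem pow_totient_le_norm_eval_cyclotomic {n : ℕ} (hn : n ≠ 0) (z : ℂ) :
    |‖z‖ - 1| ^ n.totient ≤ ‖(cyclotomic n ℂ).eval z‖ := by
  have hζ := Complex.isPrimitiveRoot_exp n hn
  rw [cyclotomic_eq_prod_X_sub_primitiveRoots hζ, eval_prod, norm_prod, ← hζ.card_primitiveRoots,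
    ← Finset.prod_const]
  refine Finset.prod_le_prod (fun _ _ => abs_nonneg _) fun μ hμ => ?_
  rw [← ((mem_primitiveRoots (Nat.pos_of_ne_zero hn)).1 hμ).norm'_eq_one hn, eval_sub, eval_X,
    eval_C]
  exact abs_norm_sub_norm_le z μ

end CyclotomicPolynomials

section CyclotomicNorm

variable {d : ℤ}

/-- The norm of `Φₙ(a)`, where `Φₙ` is the `n`-th cyclotomic polynomial. For `n = 4 * k` it plays
the role of the primitive part of `(a ^ k).x`. -/
noncomputable def cyclotomicNorm (a : Pell.Solution₁ d) (n : ℕ) : ℤ :=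
  (aeval (a : ℤ√d) (cyclotomic n ℤ)).norm

theorem norm_pell_sq_add_one (a : Pell.Solution₁ d) : ((a : ℤ√d) ^ 2 + 1).norm = 4 * a.x ^ 2 := by
  have hnorm : ((a : ℤ√d) ^ 2 + 1).norm =
      (a.x ^ 2 + d * a.y ^ 2 + 1) ^ 2 - d * (2 * a.x * a.y) ^ 2 := by
    simp only [Zsqrtd.norm_def, sq, Zsqrtd.re_add, Zsqrtd.im_add, Zsqrtd.re_mul, Zsqrtd.im_mul,
      Zsqrtd.re_one, Zsqrtd.im_one, Pell.Solution₁.x, Pell.Solution₁.y]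
    ring
  rw [hnorm]
  linear_combination (a.x ^ 2 - d * a.y ^ 2 - 1) * a.prop

theorem cyclotomicNorm_dvd_sq {a : Pell.Solution₁ d} {k q : ℕ} (hk : k ≠ 0) (hq : Odd q)
    (hq1 : 1 < q) (hx : (a ^ k).x ≠ 0) {h : ℤ} (hh : (a ^ (k * q)).x = (a ^ k).x * h) :
    cyclotomicNorm a (4 * (k * q)) ∣ h ^ 2 := by
  have hnorm (j : ℕ) : ((a : ℤ√d) ^ (2 * j) + 1).norm = 4 * (a ^ j).x ^ 2 := by
    rw [← norm_pell_sq_add_one, mul_comm, pow_mul]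
    rfl
  obtain ⟨H, hH⟩ := X_pow_add_one_mul_cyclotomic_dvd (mul_ne_zero two_ne_zero hk) hq hq1
  have hprod := congrArg (fun P => (aeval (a : ℤ√d) P).norm) hH
  simp only [map_add, map_mul, map_pow, map_one, aeval_X, Zsqrtd.norm_mul, mul_assoc, hnorm,
    hh] at hprod
  have h4 : 4 * (a ^ k).x ^ 2 ≠ 0 := mul_ne_zero four_ne_zero (pow_ne_zero 2 hx)
  refine ⟨(aeval (a : ℤ√d) H).norm, mul_left_cancel₀ h4 ?_⟩
  rw [cyclotomicNorm, show 4 * (k * q) = 2 * (2 * (k * q)) by ring]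
  linear_combination hprod

theorem cyclotomicNorm_dvd_sq_of_odd {a : Pell.Solution₁ d} {k : ℕ} (hk : Odd k) (hk1 : 1 < k)
    (hx : a.x ≠ 0) {h : ℤ} (hh : (a ^ k).x = a.x * h) : cyclotomicNorm a (4 * k) ∣ h ^ 2 := by
  simpa only [one_mul] using cyclotomicNorm_dvd_sq one_ne_zero hk hk1 (by rwa [pow_one])
    (by rwa [one_mul, pow_one])

theorem pell_coe_add_star (a : Pell.Solution₁ d) :
    (a : ℤ√d) + star (a : ℤ√d) = (2 * a.x : ℤ) := by
  ext <;> simp [Pell.Solution₁.x, two_mul]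

theorem intCast_cyclotomicNorm {R : Type*} [CommRing R] (f : ℤ√d →+* R) (a : Pell.Solution₁ d)
    (n : ℕ) :
    (cyclotomicNorm a n : R) =
      (cyclotomic n R).eval (f a) * (cyclotomic n R).eval (f (star (a : ℤ√d))) := by
  have hmap (x : ℤ√d) : f (aeval x (cyclotomic n ℤ)) = (cyclotomic n R).eval (f x) := by
    rw [← map_cyclotomic_int n R, eval_map, aeval_def, hom_eval₂, RingHom.ext_int (f.comp _)]
  have hstar :
      star (aeval (a : ℤ√d) (cyclotomic n ℤ)) = aeval (star (a : ℤ√d)) (cyclotomic n ℤ) := by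
    rw [← starRingEnd_apply, aeval_def, hom_eval₂, aeval_def, RingHom.ext_int (RingHom.comp _ _),
      starRingEnd_apply]
  rw [← hmap, ← hmap, ← hstar, ← map_mul, ← Zsqrtd.norm_eq_mul_conj, map_intCast, cyclotomicNorm]

theorem pow_totient_le_abs_cyclotomicNorm {a : Pell.Solution₁ d} (ha : 1 ≤ a.x) {n : ℕ}
    (hn : n ≠ 0) : (2 * a.x - 2) ^ n.totient ≤ |cyclotomicNorm a n| := by
  obtain ⟨r, hr⟩ := IsAlgClosed.exists_eq_mul_self (d : ℂ)
  let f : ℤ√d →+* ℂ := Zsqrtd.lift ⟨r, hr.symm⟩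
  set u := f a
  set v := f (star (a : ℤ√d))
  have huv : u * v = 1 := by
    rw [← map_mul, Unitary.mul_star_self_of_mem a.2, map_one]
  have hadd : u + v = (2 * a.x : ℤ) := by
    rw [← map_add, pell_coe_add_star, map_intCast]
  have hnorm : ‖u‖ * ‖v‖ = 1 := by rw [← norm_mul, huv, norm_one]
  have hbound : (2 * a.x - 2 : ℝ) ≤ |‖u‖ - 1| * |‖v‖ - 1| := by
    have htri : (2 * a.x : ℝ) ≤ ‖u‖ + ‖v‖ := by
      have := norm_add_le u v
      rw [hadd, Complex.norm_intCast] at this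
      exact_mod_cast (le_abs_self _).trans this
    rw [← abs_mul]
    refine le_trans ?_ (neg_le_abs _)
    linear_combination htri + hnorm
  have hreal : (2 * a.x - 2 : ℝ) ^ n.totient ≤ |(cyclotomicNorm a n : ℝ)| := by
    rw [← Complex.norm_intCast, intCast_cyclotomicNorm f, norm_mul]
    calc (2 * a.x - 2 : ℝ) ^ n.totient ≤ (|‖u‖ - 1| * |‖v‖ - 1|) ^ n.totient := by
          gcongr
          have : (1 : ℝ) ≤ a.x := by exact_mod_cast ha
          linarith
      _ = |‖u‖ - 1| ^ n.totient * |‖v‖ - 1| ^ n.totient := mul_pow _ _ _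
      _ ≤ _ := by gcongr <;> exact pow_totient_le_norm_eval_cyclotomic hn _
  exact_mod_cast hreal

theorem sq_lt_abs_cyclotomicNorm {a : Pell.Solution₁ d} (ha : 1 < a.x) {k : ℕ} (hk : Odd k)
    (hk1 : 1 < k) : (k : ℤ) ^ 2 < |cyclotomicNorm a (4 * k)| := by
  have htot : (4 * k).totient = k.totient * 2 := by
    rw [Nat.totient_mul (Nat.Coprime.pow_left 2 (Nat.coprime_two_left.2 hk)), mul_comm]
    rfl
  calc (k : ℤ) ^ 2 < (2 ^ k.totient) ^ 2 := by
        gcongr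
        exact_mod_cast lt_two_pow_totient_of_odd hk hk1
    _ = 2 ^ (4 * k).totient := by rw [htot, pow_mul]
    _ ≤ (2 * a.x - 2) ^ (4 * k).totient := by gcongr; omega
    _ ≤ |cyclotomicNorm a (4 * k)| := pow_totient_le_abs_cyclotomicNorm (by omega) (by omega)

theorem odd_cyclotomicNorm {a : Pell.Solution₁ d} (ha : a.x ≠ 0) (heven : Even a.x) {k : ℕ}
    (hk : Odd k) (hk1 : 1 < k) : Odd (cyclotomicNorm a (4 * k)) := by
  obtain ⟨h, hh⟩ := pell_x_dvd_x_pow a hk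
  rw [← Int.not_even_iff_odd, even_iff_two_dvd]
  intro htwo
  have h2k : (2 : ℤ) ∣ k := dvd_of_dvd_pell_cofactor ha hk hh
    ((even_iff_two_dvd.1 heven).trans (dvd_pow_self _ two_ne_zero))
    (Int.prime_two.dvd_of_dvd_pow (htwo.trans (cyclotomicNorm_dvd_sq_of_odd hk hk1 ha hh)))
  exact (Nat.not_even_iff_odd.2 hk) (even_iff_two_dvd.2 (by exact_mod_cast h2k))

theorem dvd_pell_x_of_dvd_x_pow_prime {a : Pell.Solution₁ d} {p : ℕ} (hp : p.Prime)
    (hodd : Odd p) (h : (p : ℤ) ∣ (a ^ p).x) : (p : ℤ) ∣ a.x := by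
  obtain ⟨r, hr⟩ := exists_add_pow_prime_eq hp (a : ℤ√d) (star (a : ℤ√d))
  have hpow : (a : ℤ√d) ^ p + star (a : ℤ√d) ^ p = (2 * (a ^ p).x : ℤ) := by
    rw [← star_pow, ← pell_coe_add_star]
    rfl
  rw [hpow, pell_coe_add_star] at hr
  have hdvd : ((p : ℤ) : ℤ√d) ∣ ((2 * a.x) ^ p : ℤ) := by
    rw [Int.cast_pow, hr]
    refine dvd_add ((Zsqrtd.intCast_dvd_intCast _ _).2 (h.mul_left 2)) ?_
    exact ⟨a * star (a : ℤ√d) * r, by push_cast; ring⟩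
  have hpZ := Nat.prime_iff_prime_int.1 hp
  have hdvd2 := hpZ.dvd_of_dvd_pow ((Zsqrtd.intCast_dvd_intCast _ _).1 hdvd)
  exact (hpZ.dvd_or_dvd hdvd2).resolve_left fun htwo =>
    hp.ne_one ((Nat.coprime_two_right.2 hodd).eq_one_of_dvd (by exact_mod_cast htwo))

theorem not_sq_dvd_pell_cofactor_prime {a : Pell.Solution₁ d} (ha : a.x ≠ 0) {p : ℕ}
    (hp : p.Prime) (hodd : Odd p) {h : ℤ} (hh : (a ^ p).x = a.x * h) : ¬ (p : ℤ) ^ 2 ∣ h := by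
  intro hsq
  have hpx : (p : ℤ) ∣ a.x := dvd_pell_x_of_dvd_x_pow_prime hp hodd
    (hh ▸ (dvd_trans (dvd_pow_self _ two_ne_zero) hsq).mul_left _)
  have hdvd := dvd_of_dvd_pell_cofactor ha hodd hh (pow_dvd_pow_of_dvd hpx 2) hsq
  have hle : 2 ≤ 1 :=
    (Nat.pow_dvd_pow_iff_le_right hp.one_lt).1 (by rw [pow_one]; exact_mod_cast hdvd)
  omega

theorem not_cube_dvd_cyclotomicNorm {a : Pell.Solution₁ d} (ha : 1 < a.x) {k p : ℕ} (hk : Odd k)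
    (hp : p.Prime) (hpk : p ∣ k) : ¬ (p : ℤ) ^ 3 ∣ cyclotomicNorm a (4 * k) := by
  obtain ⟨l, rfl⟩ := hpk
  obtain ⟨hodd, hl⟩ := Nat.odd_mul.1 hk
  have hx : (a ^ l).x ≠ 0 := (Pell.Solution₁.x_pow_pos (by omega) l).ne'
  obtain ⟨h, hh⟩ := pell_x_dvd_x_pow (a ^ l) hodd
  intro hcube
  have hdvd : cyclotomicNorm a (4 * (p * l)) ∣ h ^ 2 := by
    rw [mul_comm p]
    exact cyclotomicNorm_dvd_sq hl.pos.ne' hodd hp.one_lt hx (by rw [pow_mul, hh])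
  have hpZ := Nat.prime_iff_prime_int.1 hp
  have hsq : (p : ℤ) ^ 3 ∣ h ^ 2 := hcube.trans hdvd
  obtain ⟨h, rfl⟩ := hpZ.dvd_of_dvd_pow ((dvd_pow_self _ three_ne_zero).trans hsq)
  rw [mul_pow, pow_succ, mul_dvd_mul_iff_left (pow_ne_zero 2 hpZ.ne_zero)] at hsq
  refine not_sq_dvd_pell_cofactor_prime hx hp hodd hh ?_
  rw [sq]
  exact mul_dvd_mul_left _ (hpZ.dvd_of_dvd_pow hsq)

theorem exists_prime_dvd_cyclotomicNorm_not_dvd {a : Pell.Solution₁ d} (ha : 1 < a.x) {k : ℕ}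
    (hk : Odd k) (hk1 : 1 < k) :
    ∃ p : ℕ, p.Prime ∧ (p : ℤ) ∣ cyclotomicNorm a (4 * k) ∧ ¬ p ∣ k := by
  by_contra! hdvd
  have hsq : (cyclotomicNorm a (4 * k)).natAbs ∣ k ^ 2 := by
    refine dvd_sq_of_forall_prime_dvd_not_cube_dvd fun p hp hpN => ?_
    have hpk := hdvd p hp (Int.natCast_dvd.2 hpN)
    refine ⟨hpk, fun hcube => not_cube_dvd_cyclotomicNorm ha hk hp hpk ?_⟩
    exact_mod_cast Int.natCast_dvd.2 hcube
  have hle := Nat.le_of_dvd (by positivity) hsq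
  have hlt := sq_lt_abs_cyclotomicNorm ha hk hk1
  rw [Int.abs_eq_natAbs] at hlt
  exact absurd (by exact_mod_cast hlt) hle.not_gt

theorem not_dvd_pell_x_pow_of_dvd_cyclotomicNorm {a : Pell.Solution₁ d} (ha : 1 < a.x) {k p : ℕ}
    (hp : p.Prime) (hpN : (p : ℤ) ∣ cyclotomicNorm a (4 * k)) (hpk : ¬ p ∣ k)
    (hxk : (p : ℤ) ∣ (a ^ k).x) {j : ℕ} (hj : 0 < j) (hjk : j < k) : ¬ (p : ℤ) ∣ (a ^ j).x := by
  intro hxj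
  classical
  have hex : ∃ j, 0 < j ∧ (p : ℤ) ∣ (a ^ j).x := ⟨j, hj, hxj⟩
  obtain ⟨hg, hxg⟩ := Nat.find_spec hex
  have hgj := Nat.find_min' hex ⟨hj, hxj⟩
  have hmin (i : ℕ) (hi : 0 < i) (hig : i < Nat.find hex) : ¬ (p : ℤ) ∣ (a ^ i).x :=
    fun hxi => Nat.find_min hex hig ⟨hi, hxi⟩
  generalize Nat.find hex = g at *
  have hpZ := Nat.prime_iff_prime_int.1 hp
  obtain ⟨q, hq, rfl⟩ := exists_odd_eq_mul_of_dvd_pell_x_pow hpZ.not_isUnit hxg hmin k hxk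
  have hq1 : 1 < q := by by_contra! h; interval_cases q <;> omega
  obtain ⟨h, hh⟩ := pell_x_dvd_x_pow (a ^ g) hq
  rw [← pow_mul] at hh
  have hx : (a ^ g).x ≠ 0 := (Pell.Solution₁.x_pow_pos (by omega) g).ne'
  have hph := hpZ.dvd_of_dvd_pow (hpN.trans (cyclotomicNorm_dvd_sq hg.ne' hq hq1 hx hh))
  have hpq := dvd_of_dvd_pell_cofactor hx hq (by rwa [← pow_mul])
    (hxg.trans (dvd_pow_self _ two_ne_zero)) hph
  exact hpk (Dvd.dvd.mul_left (by exact_mod_cast hpq) g)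

theorem exists_odd_primitive_prime_dvd_pell_x_pow {a : Pell.Solution₁ d} (ha : 1 < a.x)
    (heven : Even a.x) {k : ℕ} (hk : Odd k) (hk1 : 1 < k) :
    ∃ p : ℕ, p.Prime ∧ Odd p ∧ (p : ℤ) ∣ (a ^ k).x ∧
      ∀ j, 0 < j → j < k → ¬ (p : ℤ) ∣ (a ^ j).x := by
  obtain ⟨p, hp, hpN, hpk⟩ := exists_prime_dvd_cyclotomicNorm_not_dvd ha hk hk1
  obtain ⟨h, hh⟩ := pell_x_dvd_x_pow a hk
  have hNh := cyclotomicNorm_dvd_sq_of_odd hk hk1 (by omega) hh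
  have hxk : (p : ℤ) ∣ (a ^ k).x :=
    hh ▸ ((Nat.prime_iff_prime_int.1 hp).dvd_of_dvd_pow (hpN.trans hNh)).mul_left _
  refine ⟨p, hp, ?_, hxk,
    fun j hj hjk => not_dvd_pell_x_pow_of_dvd_cyclotomicNorm ha hp hpN hpk hxk hj hjk⟩
  exact (Int.natAbs_odd.2 (odd_cyclotomicNorm (by omega) heven hk hk1)).of_dvd_nat
    (Int.natCast_dvd.1 hpN)

end CyclotomicNorm

section PellRepresentation

theorem exists_pell_x_pow_eq {n₀ : ℤ} (hn₀ : 1 < n₀) :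
    ∃ d : ℤ, ∃ a : Pell.Solution₁ d, 1 < a.x ∧
      ∀ n, 0 < n → IsSquare ((n ^ 2 - 1) * (n₀ ^ 2 - 1)) → ∃ k : ℕ, n = (a ^ k).x := by
  have hpos : 0 < n₀ ^ 2 - 1 := by nlinarith
  obtain ⟨d, b, hdb, hd⟩ : ∃ d b : ℤ, n₀ ^ 2 - 1 = d * b ^ 2 ∧ Squarefree d := by
    obtain ⟨d, b, h, hd⟩ := Nat.sq_mul_squarefree (n₀ ^ 2 - 1).toNat
    refine ⟨d, b, ?_, Int.squarefree_natCast.2 hd⟩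
    rw [← Int.toNat_of_nonneg hpos.le, ← h]
    push_cast
    ring
  have hb : b ≠ 0 := by
    rintro rfl
    exact hpos.ne' (by rw [hdb]; ring)
  have hsol (n : ℤ) (hsq : IsSquare ((n ^ 2 - 1) * (n₀ ^ 2 - 1))) :
      ∃ a : Pell.Solution₁ d, a.x = n ∧ 0 ≤ a.y := by
    rw [hdb, ← mul_assoc] at hsq
    obtain ⟨v, hv⟩ := exists_eq_mul_sq_of_isSquare_mul hd (isSquare_of_isSquare_mul_sq hb hsq)
    exact ⟨Pell.Solution₁.mk n |v| (by rw [sq_abs]; linear_combination hv), rfl, abs_nonneg v⟩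
  obtain ⟨a₀, rfl, -⟩ := hsol n₀ ⟨_, rfl⟩
  obtain ⟨a, ha⟩ := Pell.IsFundamental.exists_of_not_isSquare
    (Pell.Solution₁.d_pos_of_one_lt_x hn₀) (Pell.Solution₁.d_nonsquare_of_one_lt_x hn₀)
  refine ⟨d, a, ha.1, fun n hn hsq => ?_⟩
  obtain ⟨u, rfl, hu⟩ := hsol n hsq
  obtain ⟨k, rfl⟩ := ha.eq_pow_of_nonneg hn hu
  exact ⟨k, rfl⟩

theorem exists_prime_dvd_unique_of_isSquare {ι : Type*} {t : Finset ι} {m : ι → ℤ}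
    (hinj : Set.InjOn m t) (hm : ∀ i ∈ t, 1 < m i) {i₀ : ι} (hi₀ : i₀ ∈ t)
    (hsq : ∀ i ∈ t, IsSquare (((2 * m i) ^ 2 - 1) * ((2 * m i₀) ^ 2 - 1))) :
    ∃ i ∈ t, ∃ p : ℤ, Prime p ∧ p ∣ m i ∧ ∀ j ∈ t, j ≠ i → ¬ p ∣ m j := by
  obtain ⟨d, a, ha, hpow⟩ := exists_pell_x_pow_eq (n₀ := 2 * m i₀) (by linarith [hm i₀ hi₀])
  have hexp (i) (hi : i ∈ t) : ∃ k : ℕ, 2 * m i = (a ^ k).x :=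
    hpow _ (by linarith [hm i hi]) (hsq i hi)
  choose! k hk using hexp
  have hodd (i) (hi : i ∈ t) : Odd (k i) ∧ Even a.x :=
    (pell_even_x_pow_iff a _).1 (hk i hi ▸ even_two_mul _)
  obtain ⟨i, hi, hmax⟩ := Finset.exists_max_image t k ⟨i₀, hi₀⟩
  have hlt (j) (hj : j ∈ t) (hji : j ≠ i) : k j < k i := by
    refine (hmax j hj).lt_of_ne fun h => hji (hinj hj hi ?_)
    have := hk j hj
    rw [h, ← hk i hi] at this
    omega
  refine ⟨i, hi, ?_⟩
  rcases Nat.lt_or_ge 1 (k i) with hki | hki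
  · obtain ⟨p, hp, hp2, hpi, hpj⟩ :=
      exists_odd_primitive_prime_dvd_pell_x_pow ha (hodd i hi).2 (hodd i hi).1 hki
    have hpZ := Nat.prime_iff_prime_int.1 hp
    have htwo : ¬ (p : ℤ) ∣ 2 := fun htwo =>
      hp.ne_one ((Nat.coprime_two_right.2 hp2).eq_one_of_dvd (by exact_mod_cast htwo))
    refine ⟨p, hpZ, (hpZ.dvd_or_dvd (hk i hi ▸ hpi)).resolve_left htwo, fun j hj hji hpm => ?_⟩
    exact hpj (k j) (hodd j hj).1.pos (hlt j hj hji) (hk j hj ▸ hpm.mul_left 2)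
  · obtain ⟨p, hp, hpi⟩ := Int.exists_prime_and_dvd (n := m i) (by have := hm i hi; omega)
    refine ⟨p, hp, hpi, fun j hj hji => ?_⟩
    have := (hodd j hj).1.pos
    have := hlt j hj hji
    omega

end PellRepresentation

section Integrality

variable {K : Type*} [Field K]

theorem mul_dvd_add_pow_sub_pow_sub_pow {R : Type*} [CommRing R] (x y : R) (k : ℕ) :
    x * y ∣ (x + y) ^ (k + 1) - x ^ (k + 1) - y ^ (k + 1) := by
  induction k with
  | zero => simp
  | succ k ih =>
    obtain ⟨r, hr⟩ := ih
    exact ⟨(x + y) * r + x ^ k + y ^ k, by linear_combination (x + y) * hr⟩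

theorem dvd_of_isIntegral_of_eq_mul [CharZero K] {m n : ℤ} (hm : m ≠ 0) {x : K}
    (hx : IsIntegral ℤ x) (h : (n : K) = m * x) : m ∣ n := by
  have hm' : (m : K) ≠ 0 := Int.cast_ne_zero.2 hm
  obtain ⟨k, rfl⟩ := hx.exists_int_iff_exists_rat.1 ⟨n / m, by push_cast; rw [h]; field_simp⟩
  exact ⟨k, by exact_mod_cast h⟩

theorem ne_zero_of_add_inv_eq_inv {m : ℤ} {z : K} (hm : (m : K) ≠ 0) (hz : z + z⁻¹ = (m : K)⁻¹) :
    z ≠ 0 := by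
  rintro rfl
  exact inv_ne_zero hm (by simpa using hz.symm)

theorem isIntegral_intCast_mul_of_add_inv_eq_inv {m : ℤ} {z : K} (hm : (m : K) ≠ 0)
    (hz : z + z⁻¹ = (m : K)⁻¹) : IsIntegral ℤ (m * z) := by
  have hz0 := ne_zero_of_add_inv_eq_inv hm hz
  refine ⟨X ^ 2 - X + C (m ^ 2), by monicity!, ?_⟩
  have hquad : m * z ^ 2 - z + m = 0 := by
    field_simp at hz
    linear_combination hz
  simp only [← aeval_def, map_add, map_sub, map_pow, aeval_X, eq_intCast, map_intCast]
  linear_combination (m : K) * hquad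

theorem isIntegral_pow_natAbs_mul_zpow {m : ℤ} {z : K} (hm : (m : K) ≠ 0)
    (hz : z + z⁻¹ = (m : K)⁻¹) (e : ℤ) : IsIntegral ℤ ((m : K) ^ e.natAbs * z ^ e) := by
  have hz' : z⁻¹ + z⁻¹⁻¹ = (m : K)⁻¹ := by rwa [inv_inv, add_comm]
  cases e with
  | ofNat n => simpa [mul_pow] using (isIntegral_intCast_mul_of_add_inv_eq_inv hm hz).pow n
  | negSucc n => simpa [mul_pow] using (isIntegral_intCast_mul_of_add_inv_eq_inv hm hz').pow (n + 1)

theorem dvd_of_isIntegral_mul_zpow [CharZero K] {m n c : ℤ} {z : K} (hm : m ≠ 0)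
    (hz : z + z⁻¹ = (m : K)⁻¹) (hc : c ≠ 0) (h₁ : IsIntegral ℤ (n * z ^ c))
    (h₂ : IsIntegral ℤ (n * (z ^ c)⁻¹)) : m ∣ n := by
  have hm' : (m : K) ≠ 0 := Int.cast_ne_zero.2 hm
  have hz0 := ne_zero_of_add_inv_eq_inv hm' hz
  have hz' : z⁻¹ + z⁻¹⁻¹ = (m : K)⁻¹ := by rwa [inv_inv, add_comm]
  -- With `u = m z` and `v = m z⁻¹`, expand `1 = (u + v) ^ (k + 1)`; all mixed terms are multiples
  -- of `u v = m ^ 2`.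
  let u : integralClosure ℤ K := ⟨m * z, isIntegral_intCast_mul_of_add_inv_eq_inv hm' hz⟩
  let v : integralClosure ℤ K := ⟨m * z⁻¹, isIntegral_intCast_mul_of_add_inv_eq_inv hm' hz'⟩
  obtain ⟨k, hk⟩ := Nat.exists_eq_add_one_of_ne_zero (Int.natAbs_ne_zero.2 hc)
  obtain ⟨w, hw⟩ := mul_dvd_add_pow_sub_pow_sub_pow u v k
  have hexpand : (m * z + m * z⁻¹) ^ (k + 1) - (m * z) ^ (k + 1) - (m * z⁻¹) ^ (k + 1) =
      m * z * (m * z⁻¹) * w := congrArg Subtype.val hw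
  have hadd : m * z + m * z⁻¹ = 1 := by rw [← mul_add, hz, mul_inv_cancel₀ hm']
  have hpow : z ^ (k + 1) + z⁻¹ ^ (k + 1) = z ^ c + (z ^ c)⁻¹ := by
    rw [inv_pow, ← zpow_natCast z (k + 1), ← hk]
    rcases Int.natAbs_eq c with h | h
    · rw [← h]
    · rw [← neg_eq_iff_eq_neg.2 h, zpow_neg, inv_inv, add_comm]
  refine dvd_of_isIntegral_of_eq_mul hm (x := m ^ k * (n * z ^ c + n * (z ^ c)⁻¹) + n * m * w) ?_ ?_
  · exact (((isIntegral_intCast m).pow k).mul (h₁.add h₂)).add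
      (((isIntegral_intCast n).mul (isIntegral_intCast m)).mul w.2)
  · rw [hadd, one_pow] at hexpand
    have hzz : z * z⁻¹ = 1 := mul_inv_cancel₀ hz0
    linear_combination n * hexpand + n * m ^ (k + 1) * hpow + n * m ^ 2 * w * hzz

theorem dvd_prod_erase_of_prod_zpow_eq_one [CharZero K] {ι : Type*} [DecidableEq ι] {s : Finset ι}
    {m c : ι → ℤ} {z : ι → K} (hm : ∀ i ∈ s, m i ≠ 0) (hz : ∀ i ∈ s, z i + (z i)⁻¹ = (m i : K)⁻¹)
    (hrel : ∏ i ∈ s, z i ^ c i = 1) {i : ι} (hi : i ∈ s) (hc : c i ≠ 0) :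
    m i ∣ ∏ j ∈ s.erase i, m j ^ (c j).natAbs := by
  rw [← Finset.mul_prod_erase s _ hi] at hrel
  have hint (e : ι → ℤ) (he : ∀ j, (e j).natAbs = (c j).natAbs) :
      IsIntegral ℤ (((∏ j ∈ s.erase i, m j ^ (c j).natAbs : ℤ) : K) *
        ∏ j ∈ s.erase i, z j ^ e j) := by
    push_cast
    rw [← Finset.prod_mul_distrib]
    refine IsIntegral.prod _ fun j hj => ?_
    have hj := Finset.mem_of_mem_erase hj
    rw [← he]
    exact isIntegral_pow_natAbs_mul_zpow (Int.cast_ne_zero.2 (hm j hj)) (hz j hj) _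
  refine dvd_of_isIntegral_mul_zpow (hm i hi) (hz i hi) hc ?_ ?_
  · have := hint (fun j => -c j) fun j => Int.natAbs_neg _
    simpa only [zpow_neg, Finset.prod_inv_distrib, ← eq_inv_of_mul_eq_one_left hrel] using this
  · simpa only [← eq_inv_of_mul_eq_one_right hrel] using hint c fun _ => rfl

end Integrality

section SignCharacters

variable {F K ι : Type*} [CommGroupWithZero K] [FunLike F K K] [MonoidWithZeroHomClass F K K]
  {s : Finset ι} {z : ι → K} {χ : ι → F → ℤˣ} {c : ι → ℤ}

-- Apply `1 + ψ σ • σ`, written additively, to the relation for each `σ ∈ B`. If `ψ σ ≠ χ i σ`, the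
-- factor `1 + ψ σ * χ i σ` is zero and `z i` drops out.
theorem prod_zpow_mul_prod_one_add_eq_one (hz : ∀ i ∈ s, z i ≠ 0)
    (hχ : ∀ i ∈ s, ∀ σ : F, σ (z i) = z i ^ (χ i σ : ℤ)) (hrel : ∏ i ∈ s, z i ^ c i = 1)
    (ψ : F → ℤˣ) (B : Finset F) :
    ∏ i ∈ s, z i ^ (c i * ∏ σ ∈ B, (1 + (ψ σ * χ i σ : ℤ))) = 1 := by
  classical
  induction B using Finset.induction_on with
  | empty => simpa using hrel
  | insert σ B hσ ih =>
    set e : ι → ℤ := fun i => c i * ∏ σ ∈ B, (1 + (ψ σ * χ i σ : ℤ))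
    have hσe : ∏ i ∈ s, z i ^ (χ i σ * e i : ℤ) = 1 := by
      rw [← map_one σ, ← ih, map_prod]
      refine Finset.prod_congr rfl fun i hi => ?_
      rw [map_zpow₀, hχ i hi, zpow_mul]
    calc ∏ i ∈ s, z i ^ (c i * ∏ τ ∈ insert σ B, (1 + (ψ τ * χ i τ : ℤ)))
        = ∏ i ∈ s, z i ^ e i * (z i ^ (χ i σ * e i : ℤ)) ^ (ψ σ : ℤ) := by
          refine Finset.prod_congr rfl fun i hi => ?_
          rw [← zpow_mul, ← zpow_add₀ (hz i hi), Finset.prod_insert hσ]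
          congr 1
          ring
      _ = 1 := by rw [Finset.prod_mul_distrib, Finset.prod_zpow, hσe, ih, one_zpow, one_mul]

theorem exists_prod_filter_zpow_mul_eq_one [DecidableEq (F → ℤˣ)] (hz : ∀ i ∈ s, z i ≠ 0)
    (hχ : ∀ i ∈ s, ∀ σ : F, σ (z i) = z i ^ (χ i σ : ℤ)) (hrel : ∏ i ∈ s, z i ^ c i = 1)
    (ψ : F → ℤˣ) : ∃ N : ℤ, N ≠ 0 ∧ ∏ i ∈ s with χ i = ψ, z i ^ (c i * N) = 1 := by
  classical
  have hsep (i : ι) (hi : i ∈ s.filter fun i => χ i ≠ ψ) : ∃ σ, χ i σ ≠ ψ σ :=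
    Function.ne_iff.1 (Finset.mem_filter.1 hi).2
  choose τ hτ using hsep
  let B : Finset F := (s.filter fun i => χ i ≠ ψ).attach.image fun i => τ i.1 i.2
  refine ⟨2 ^ B.card, pow_ne_zero _ two_ne_zero, ?_⟩
  rw [← prod_zpow_mul_prod_one_add_eq_one hz hχ hrel ψ B, Finset.prod_filter]
  refine Finset.prod_congr rfl fun i hi => ?_
  split_ifs with h
  · have hone (σ : F) : (1 + (ψ σ * ψ σ) : ℤ) = 2 := by
      rw [← Units.val_mul, Int.units_mul_self, Units.val_one, one_add_one_eq_two]
    simp only [h, hone, Finset.prod_const]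
  · have hi' : i ∈ s.filter fun i => χ i ≠ ψ := Finset.mem_filter.2 ⟨hi, h⟩
    have hmem : τ i hi' ∈ B := Finset.mem_image.2 ⟨⟨i, hi'⟩, Finset.mem_attach _ _, rfl⟩
    have hneg : (1 + (ψ (τ i hi') * χ i (τ i hi')) : ℤ) = 0 := by
      rw [Int.units_ne_iff_eq_neg.1 (hτ i hi'), Units.val_neg, mul_neg, ← Units.val_mul,
        Int.units_mul_self, Units.val_one, add_neg_cancel]
    rw [Finset.prod_eq_zero hmem hneg, mul_zero, zpow_zero]

end SignCharacters

section GaloisConjugates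

variable {K ι : Type*} [Field K]

theorem exists_eq_zpow_units_of_add_inv_eq {x y : K} (hx : x ≠ 0) (hy : y ≠ 0)
    (h : x + x⁻¹ = y + y⁻¹) : ∃ e : ℤˣ, x = y ^ (e : ℤ) := by
  have hprod : (x - y) * (x * y - 1) = 0 := by
    field_simp at h
    linear_combination h
  rcases mul_eq_zero.1 hprod with h | h
  · exact ⟨1, by simpa using sub_eq_zero.1 h⟩
  · exact ⟨-1, by simpa using eq_inv_of_mul_eq_one_left (sub_eq_zero.1 h)⟩

theorem sq_mul_sub_inv_of_add_inv_eq_inv {m : ℤ} {z : K} (hm : (m : K) ≠ 0)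
    (hz : z + z⁻¹ = (m : K)⁻¹) : (m * (z - z⁻¹)) ^ 2 = 1 - (2 * m) ^ 2 := by
  have hzz : z * z⁻¹ = 1 := mul_inv_cancel₀ (ne_zero_of_add_inv_eq_inv hm hz)
  have hone : m * (z + z⁻¹) = 1 := by rw [hz, mul_inv_cancel₀ hm]
  linear_combination (m * (z + z⁻¹) + 1) * hone - 4 * (m : K) ^ 2 * hzz

theorem isSquare_of_conj_eq_zpow [Algebra ℚ K] [IsGalois ℚ K] {m n : ℤ} (hm : m ≠ 0) (hn : n ≠ 0)
    {z w : K} (hz : z + z⁻¹ = (m : K)⁻¹) (hw : w + w⁻¹ = (n : K)⁻¹) {χ : Gal(K/ℚ) → ℤˣ}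
    (hχz : ∀ σ, σ z = z ^ (χ σ : ℤ)) (hχw : ∀ σ, σ w = w ^ (χ σ : ℤ)) :
    IsSquare (((2 * m) ^ 2 - 1) * ((2 * n) ^ 2 - 1)) := by
  have := algebraRat.charZero K
  obtain ⟨r, hr⟩ : (z - z⁻¹) * (w - w⁻¹) ∈ Set.range (algebraMap ℚ K) := by
    refine (InfiniteGalois.mem_range_algebraMap_iff_fixed _).2 fun σ => ?_
    rw [map_mul, map_sub, map_sub, map_inv₀, map_inv₀, hχz, hχw]
    rcases Int.units_eq_one_or (χ σ) with h | h <;> rw [h]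
    · simp only [Units.val_one, zpow_one]
    · simp only [Units.val_neg, Units.val_one, zpow_neg, zpow_one, inv_inv]
      ring
  have hz2 := sq_mul_sub_inv_of_add_inv_eq_inv (Int.cast_ne_zero.2 hm) hz
  have hw2 := sq_mul_sub_inv_of_add_inv_eq_inv (Int.cast_ne_zero.2 hn) hw
  rw [← Rat.isSquare_intCast_iff]
  refine ⟨m * n * r, (algebraMap ℚ K).injective ?_⟩
  simp only [map_mul, map_intCast, hr]
  push_cast
  linear_combination -(1 - (2 * n : K) ^ 2) * hz2 - (m * (z - z⁻¹)) ^ 2 * hw2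

theorem exponents_eq_zero_of_prod_zpow_eq_one_of_isGalois [Algebra ℚ K] [IsGalois ℚ K]
    {s : Finset ι} {m c : ι → ℤ} {z : ι → K} (hinj : Set.InjOn m s) (hm : ∀ i ∈ s, 1 < m i)
    (hz : ∀ i ∈ s, z i + (z i)⁻¹ = (m i : K)⁻¹) (hrel : ∏ i ∈ s, z i ^ c i = 1) :
    ∀ i ∈ s, c i = 0 := by
  classical
  have := algebraRat.charZero K
  have hm0 (i) (hi : i ∈ s) : m i ≠ 0 := by have := hm i hi; omega
  have hz0 (i) (hi : i ∈ s) : z i ≠ 0 :=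
    ne_zero_of_add_inv_eq_inv (Int.cast_ne_zero.2 (hm0 i hi)) (hz i hi)
  have hconj (i) (hi : i ∈ s) (σ : Gal(K/ℚ)) : ∃ e : ℤˣ, σ (z i) = z i ^ (e : ℤ) := by
    refine exists_eq_zpow_units_of_add_inv_eq (map_ne_zero σ |>.2 (hz0 i hi)) (hz0 i hi) ?_
    rw [← map_inv₀, ← map_add, hz i hi, map_inv₀, map_intCast]
  choose! χ hχ using hconj
  by_contra! ⟨i₀, hi₀, hc₀⟩
  obtain ⟨N, hN, hrelN⟩ := exists_prod_filter_zpow_mul_eq_one hz0 hχ hrel (χ i₀)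
  set t : Finset ι := {i ∈ s | χ i = χ i₀ ∧ c i ≠ 0}
  have hts (i) (hi : i ∈ t) : i ∈ s := (Finset.mem_filter.1 hi).1
  have hrelt : ∏ i ∈ t, z i ^ (c i * N) = 1 := by
    rw [← hrelN]
    refine Finset.prod_subset (fun i hi => ?_) fun i hi hit => ?_
    · grind
    · have : c i = 0 := by grind
      rw [this, zero_mul, zpow_zero]
  obtain ⟨i, hi, p, hp, hpi, hpj⟩ := exists_prime_dvd_unique_of_isSquare (t := t) (i₀ := i₀)
    (hinj.mono hts) (fun i hi => hm i (hts i hi)) (by grind) fun i hi =>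
      isSquare_of_conj_eq_zpow (hm0 i (hts i hi)) (hm0 i₀ hi₀) (hz i (hts i hi)) (hz i₀ hi₀)
        (hχ i (hts i hi)) (by grind)
  have hdvd := dvd_prod_erase_of_prod_zpow_eq_one (fun i hi => hm0 i (hts i hi))
    (fun i hi => hz i (hts i hi)) hrelt hi (mul_ne_zero (by grind) hN)
  obtain ⟨j, hj, hpm⟩ := hp.exists_mem_finset_dvd (hpi.trans hdvd)
  exact hpj j (Finset.mem_of_mem_erase hj) (Finset.ne_of_mem_erase hj) (hp.dvd_of_dvd_pow hpm)

theorem exponents_eq_zero_of_prod_zpow_eq_one [CharZero K] [IsAlgClosed K] {s : Finset ι}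
    {m c : ι → ℤ} {z : ι → K} (hinj : Set.InjOn m s) (hm : ∀ i ∈ s, 1 < m i)
    (hz : ∀ i ∈ s, z i + (z i)⁻¹ = (m i : K)⁻¹) (hrel : ∏ i ∈ s, z i ^ c i = 1) :
    ∀ i ∈ s, c i = 0 := by
  -- Without this, the `ℚ`-algebra structure of a division ring of characteristic zero is inferred.
  let : Algebra ℚ (algebraicClosure ℚ K) := (algebraicClosure ℚ K).algebra'
  have : IsGalois ℚ (algebraicClosure ℚ K) := IsAlgClosure.isGalois _ _
  have hlift (i) (hi : i ∈ s) : ∃ w : algebraicClosure ℚ K, algebraMap _ K w = z i := by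
    have hmi : (m i : K) ≠ 0 := by have := hm i hi; exact_mod_cast (by omega : m i ≠ 0)
    refine ⟨⟨z i, mem_algebraicClosure_iff'.2 ?_⟩, rfl⟩
    rw [← inv_mul_cancel_left₀ hmi (z i)]
    exact (isIntegral_intCast _).inv.mul
      (isIntegral_intCast_mul_of_add_inv_eq_inv hmi (hz i hi)).tower_top
  choose! w hw using hlift
  refine exponents_eq_zero_of_prod_zpow_eq_one_of_isGalois hinj hm (z := w) (fun i hi => ?_) ?_
  · apply (algebraMap (algebraicClosure ℚ K) K).injective
    rw [map_add, map_inv₀, map_inv₀, map_intCast, hw i hi, hz i hi]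
  · apply (algebraMap (algebraicClosure ℚ K) K).injective
    rw [map_prod, map_one, ← hrel]
    exact Finset.prod_congr rfl fun i hi => by rw [map_zpow₀, hw i hi]

end GaloisConjugates

section Arccosines

theorem exp_arccos_mul_I_add_inv {x : ℝ} (hx₁ : -1 ≤ x) (hx₂ : x ≤ 1) :
    Complex.exp (Real.arccos x * Complex.I) + (Complex.exp (Real.arccos x * Complex.I))⁻¹
      = 2 * x := by
  rw [← Complex.exp_neg, ← neg_mul, ← Complex.two_cos, ← Complex.ofReal_cos,
    Real.cos_arccos hx₁ hx₂]

theorem linearIndepOn_insert_pi {S : Set ℝ}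
    (hS : ∀ (t : Finset ℝ) (c : ℝ → ℤ), ↑t ⊆ S →
      ∏ x ∈ t, Complex.exp (x * Complex.I) ^ c x = 1 → ∀ x ∈ t, c x = 0) :
    LinearIndepOn ℚ (id : ℝ → ℝ) (insert Real.pi S) := by
  rw [LinearIndepOn, ← LinearIndependent.iff_fractionRing ℤ ℚ, ← LinearIndepOn, linearIndepOn_iff']
  intro t g hts hg
  simp only [id, zsmul_eq_mul] at hg
  have hexp (x : ℝ) : Complex.exp (x * Complex.I) ^ (2 * g x) =
      Complex.exp (2 * Complex.I * ((g x * x : ℝ) : ℂ)) := by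
    rw [← Complex.exp_int_mul]
    congr 1
    push_cast
    ring
  have hprod : ∏ x ∈ t, Complex.exp (x * Complex.I) ^ (2 * g x) = 1 := by
    simp only [hexp]
    rw [← Complex.exp_sum, ← Finset.mul_sum, ← Complex.ofReal_sum, hg, Complex.ofReal_zero,
      mul_zero, Complex.exp_zero]
  have hpi : Complex.exp (Real.pi * Complex.I) ^ (2 * g Real.pi) = 1 := by
    rw [Complex.exp_pi_mul_I, zpow_mul, even_two.neg_one_zpow, one_zpow]
  rw [← Finset.prod_erase t hpi] at hprod
  have hzero : ∀ x ∈ t, x ≠ Real.pi → g x = 0 := fun x hx hxpi => by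
    have := hS (t.erase Real.pi) _ (by grind) hprod x (Finset.mem_erase.2 ⟨hxpi, hx⟩)
    omega
  intro x hx
  by_cases hxpi : x = Real.pi
  · rw [Finset.sum_eq_single_of_mem x hx fun y hy hyx => by
      rw [hzero y hy (hxpi ▸ hyx), Int.cast_zero, zero_mul], hxpi] at hg
    rw [hxpi]
    exact_mod_cast (mul_eq_zero.1 hg).resolve_right Real.pi_ne_zero
  · exact hzero x hx hxpi

theorem mainTheorem7_general :
    LinearIndepOn ℚ (id : ℝ → ℝ)
      ({Real.pi} ∪ {x : ℝ | ∃ n : ℕ, Even n ∧ 2 < n ∧ x = Real.arccos (1 / n)}) := by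
  rw [Set.singleton_union]
  refine linearIndepOn_insert_pi fun t c ht hrel => ?_
  have hrep (x) (hx : x ∈ t) : ∃ m : ℤ, 1 < m ∧ x = Real.arccos (1 / (2 * m)) := by
    obtain ⟨n, ⟨k, rfl⟩, hn, rfl⟩ := ht hx
    exact ⟨k, by omega, by push_cast; rw [two_mul]⟩
  choose! m hm hmx using hrep
  refine exponents_eq_zero_of_prod_zpow_eq_one (m := m) (fun x hx y hy h => ?_) hm
    (fun x hx => ?_) hrel
  · rw [hmx x hx, hmx y hy, h]
  · have hm1 : (1 : ℝ) < m x := by exact_mod_cast hm x hx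
    have hpos : 0 < 1 / (2 * (m x : ℝ)) := by positivity
    have hle : 1 / (2 * (m x : ℝ)) ≤ 1 := div_le_one_of_le₀ (by linarith) (by linarith)
    have := exp_arccos_mul_I_add_inv (by linarith) hle
    rw [← hmx x hx] at this
    rw [this]
    push_cast
    field_simp

end Arccosines

theorem mainTheorem7 (P : Finset ℕ) (hP : ∀ p ∈ P, p.Prime ∧ Odd p)
    (m : ℕ) (hm : m = ∏ p ∈ P, p) :
    LinearIndepOn ℚ (id : ℝ → ℝ)
      ({Real.pi} ∪
        {x : ℝ | ∃ r : ℕ, r ∣ m ∧ 3 < r ∧ x = Real.arccos (1 / (Nat.totient r : ℝ))}) := by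
  have hmodd : Odd m := hm ▸ Finset.prod_induction _ Odd (fun _ _ => Odd.mul) odd_one
    fun p hp => (hP p hp).2
  refine mainTheorem7_general.mono (Set.union_subset_union_right _ ?_)
  rintro x ⟨r, hrm, hr, rfl⟩
  exact ⟨r.totient, Nat.totient_even (by omega),
    two_lt_totient_of_odd (hmodd.of_dvd_nat hrm) hr, rfl⟩
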